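/- Let $\Gamma$ be a group. (1) Let $d$ be a natural number and suppose that $\Gamma$ has an abelian subgroup of finite index at most $d$. Then every finite-dimensional irreducible complex representation of $\Gamma$ has dimension at most $d$. (2) Suppose that $\Gamma$ is finitely generated and residually finite, but not virtually abelian (that is, $\Gamma$ has no abelian subgroup of finite index). Then $\Gamma$ has irreducible finite-dimensional unitary representations of arbitrarily large dimension: for every $N \in \mathbb{N}$ there are $n \ge N$ and a homomorphism $\pi : \Gamma \to U(n)$ such that the only $\pi(\Gamma)$-invariant subspaces of $\mathbb{C}^n$ are $0$ and $\mathbb{C}^n$, with $\mathbb{C}^n \neq 0$. -/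

import Mathlib

/-- A group is virtually abelian if it has an abelian subgroup of finite index. -/
def IsVirtuallyAbelian (Γ : Type*) [Group Γ] : Prop :=
  ∃ A : Subgroup Γ, IsMulCommutative A ∧ A.FiniteIndex

/-- The complex linear representation on `ℂⁿ` underlying a unitary representation
`π : Γ → U(n)`: the element `g` acts by multiplication of vectors by the matrix `π g`. -/
noncomputable def unitaryRep {Γ : Type*} [Group Γ] {n : ℕ}
    (π : Γ →* Matrix.unitaryGroup (Fin n) ℂ) : Representation ℂ Γ (Fin n → ℂ) where
  toFun g := Matrix.toLin' (π g : Matrix (Fin n) (Fin n) ℂ)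
  map_one' := by simp [Module.End.one_eq_id]
  map_mul' g h := by simp [Matrix.toLin'_mul, Module.End.mul_eq_comp]

/-! (1) The abelian subgroup has a common eigenvector `v`. Elements of one left coset send `v` to
proportional vectors, so the orbit of `v` spans an invariant subspace of dimension at most the
index.

(2) Suppose all irreducible unitary dimensions are below `N`. By Jordan's theorem, each irreducible
with finite image is commutative on a subgroup of index bounded in terms of `N`. As `Γ` is finitely
generated, one finite-index `L` lies in all these subgroups. Residual finiteness makes such
irreducibles separate points: take permutation representations on finite coset spaces and split
them. Hence `L` is abelian. -/

/-- A nonzero finite-dimensional representation contains an irreducible subrepresentation. -/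
theorem Representation.exists_isIrreducible_subrepresentation {k G V : Type*} [Field k] [Monoid G]
    [AddCommGroup V] [Module k V] [FiniteDimensional k V] [Nontrivial V]
    (ρ : Representation k G V) :
    ∃ W : Subrepresentation ρ, W.toRepresentation.IsIrreducible := by
  classical
  obtain ⟨W, hW, hmin⟩ := (measure fun W : Submodule k V => Module.finrank k W).wf.has_min
    {W : Submodule k V | W ≠ ⊥ ∧ ∀ g, ∀ v ∈ W, ρ g v ∈ W} ⟨⊤, by simp⟩
  let W' : Subrepresentation ρ := ⟨W, fun g v hv => hW.2 g v hv⟩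
  refine ⟨W', ?_⟩
  have hnt : Nontrivial (Subrepresentation W'.toRepresentation) := by
    refine ⟨⊥, ⊤, fun h => hW.1 ?_⟩
    rw [eq_bot_iff]
    intro v hv
    have : (⟨v, hv⟩ : W'.toSubmodule) ∈ (⊤ : Subrepresentation W'.toRepresentation) :=
      Submodule.mem_top
    rw [← h] at this
    exact congrArg Subtype.val (show (⟨v, hv⟩ : W'.toSubmodule) = 0 from this)
  refine { hnt with eq_bot_or_eq_top := fun U => ?_ }
  by_cases hU : U.toSubmodule = ⊥
  · left
    exact Subrepresentation.toSubmodule_injective hU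
  · right
    have hle : ¬ Module.finrank k (U.toSubmodule.map W.subtype) < Module.finrank k W := by
      refine hmin _ ⟨?_, ?_⟩
      · exact fun h => hU (Submodule.map_injective_of_injective W.injective_subtype (h.trans (Submodule.map_bot _).symm))
      · rintro g _ ⟨v, hv, rfl⟩
        exact ⟨_, U.apply_mem_toSubmodule g hv, rfl⟩
    rw [Submodule.finrank_map_subtype_eq] at hle
    apply Subrepresentation.toSubmodule_injective
    exact Submodule.eq_top_of_finrank_eq (le_antisymm (Submodule.finrank_le _) (not_lt.1 hle))

theorem Representation.IsIrreducible.finrank_le_index {Γ V : Type*} [Group Γ] [AddCommGroup V]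
    [Module ℂ V] [FiniteDimensional ℂ V] {ρ : Representation ℂ Γ V} (hρ : ρ.IsIrreducible)
    (A : Subgroup Γ) [IsMulCommutative A] [A.FiniteIndex] : Module.finrank ℂ V ≤ A.index := by
  classical
  rcases subsingleton_or_nontrivial V with hV | hV
  · simp [Module.finrank_zero_of_subsingleton]
  obtain ⟨W, hW⟩ :=
    Representation.exists_isIrreducible_subrepresentation (ρ.comp A.subtype)
  have h1 := Representation.IsIrreducible.finrank_eq_one_of_isMulCommutative W.toRepresentation
  obtain ⟨v, hv0, hv⟩ := finrank_eq_one_iff'.1 h1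
  have heig : ∀ a ∈ A, ∃ c : ℂ, ρ a v = c • (v : V) := by
    intro a ha
    obtain ⟨c, hc⟩ := hv ⟨_, W.apply_mem_toSubmodule ⟨a, ha⟩ v.2⟩
    exact ⟨c, (congrArg Subtype.val hc).symm⟩
  let f : Γ ⧸ A → V := fun q => ρ q.out v
  have hf : ∀ g : Γ, ρ g v ∈ Submodule.span ℂ (Set.range f) := by
    intro g
    obtain ⟨a, ha⟩ := QuotientGroup.mk_out_eq_mul A g
    obtain ⟨c, hc⟩ := heig (a : Γ)⁻¹ (A.inv_mem a.2)
    have hg : g = (g : Γ ⧸ A).out * (a : Γ)⁻¹ := by rw [ha]; group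
    rw [hg, map_mul, Module.End.mul_apply, hc, map_smul]
    exact Submodule.smul_mem _ _ (Submodule.subset_span ⟨_, rfl⟩)
  let U : Subrepresentation ρ := ⟨Submodule.span ℂ (Set.range f), fun g w hw => by
    induction hw using Submodule.span_induction with
    | mem x hx =>
      obtain ⟨q, rfl⟩ := hx
      simp only [f]
      rw [← Module.End.mul_apply, ← map_mul]
      exact hf _
    | zero => simp
    | add x y _ _ hx hy => rw [map_add]; exact add_mem hx hy
    | smul c x _ hx => rw [map_smul]; exact Submodule.smul_mem _ _ hx⟩
  have hU : U = ⊤ := by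
    refine (hρ.eq_bot_or_eq_top U).resolve_left fun h => hv0 ?_
    have : (v : V) ∈ U := by simpa using! hf 1
    rw [h] at this
    exact Subtype.ext this
  have hspan : Submodule.span ℂ (Set.range f) = ⊤ :=
    congrArg Subrepresentation.toSubmodule hU
  have := Fintype.ofFinite (Γ ⧸ A)
  calc Module.finrank ℂ V = Module.finrank ℂ (Submodule.span ℂ (Set.range f)) := by
        rw [hspan, finrank_top]
    _ ≤ Fintype.card (Γ ⧸ A) := finrank_range_le_card f
    _ = A.index := by rw [Subgroup.index_eq_card, Nat.card_eq_fintype_card]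

/-! ### Subgroups of bounded index -/

instance Group.finite_monoidHom_of_fg {G H : Type*} [Group G] [Group.FG G] [Group H] [Finite H] :
    Finite (G →* H) := by
  obtain ⟨S, hS⟩ := Group.fg_def.1 ‹Group.FG G›
  refine Finite.of_injective (fun (f : G →* H) (s : S) => f s) fun f g hfg => ?_
  exact MonoidHom.eq_of_eqOn_dense hS fun s hs => congrFun hfg ⟨s, hs⟩

/-- In a finitely generated group, the intersection of all subgroups of bounded finite index
contains a subgroup of finite index. -/
theorem Group.exists_finiteIndex_le_of_index_le (G : Type*) [Group G] [Group.FG G] (K : ℕ) :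
    ∃ L : Subgroup G, L.FiniteIndex ∧
      ∀ H : Subgroup G, H.FiniteIndex → H.index ≤ K → L ≤ H := by
  -- Finite generation leaves finitely many kernels to intersect. `H` contains one of them, being
  -- the stabilizer of its own coset in `G ⧸ H`.
  refine ⟨⨅ k : Fin (K + 1), ⨅ f : G →* Equiv.Perm (Fin k), f.ker, ?_, fun H hH hK => ?_⟩
  · exact Subgroup.finiteIndex_iInf fun k => Subgroup.finiteIndex_iInf fun f => inferInstance
  · have e : G ⧸ H ≃ Fin H.index := Finite.equivFin (G ⧸ H)
    let f : G →* Equiv.Perm (Fin H.index) :=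
      e.permCongrHom.toMonoidHom.comp (MulAction.toPermHom G (G ⧸ H))
    refine (iInf_le_of_le (⟨H.index, Nat.lt_succ_of_le hK⟩ : Fin (K + 1)) (iInf_le _ f)).trans ?_
    intro g hg
    have h1 : f g (e (1 : G)) = e (1 : G) := by rw [MonoidHom.mem_ker.1 hg]; rfl
    have h2 : ((g * 1 : G) : G ⧸ H) = (1 : G) := by
      simpa [f, Equiv.permCongrHom] using h1
    rw [mul_one] at h2
    simpa using (QuotientGroup.eq.1 h2)

/-! ### Jordan's theorem for finite unitary groups -/

theorem Module.End.exists_inf_eigenspace_ne_bot {K V : Type*} [Field K] [IsAlgClosed K]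
    [AddCommGroup V] [Module K V] [FiniteDimensional K V] (f : Module.End K V)
    {W : Submodule K V} (hW : W ≠ ⊥) (hf : ∀ v ∈ W, f v ∈ W) :
    ∃ μ, W ⊓ f.eigenspace μ ≠ ⊥ := by
  have := Submodule.nontrivial_iff_ne_bot.2 hW
  obtain ⟨μ, hμ⟩ := Module.End.exists_eigenvalue (f.restrict hf)
  obtain ⟨v, hv⟩ := hμ.exists_hasEigenvector
  refine ⟨μ, (Submodule.ne_bot_iff _).2 ⟨v, ⟨v.2, ?_⟩, fun h => hv.2 (Subtype.ext h)⟩⟩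
  exact Module.End.mem_eigenspace_iff.2 (congrArg Subtype.val hv.apply_eq_smul)

/-- Two commuting endomorphisms have a common eigenvector in every nonzero subspace that is
invariant under both. -/
theorem Module.End.exists_common_eigenvector {K V : Type*} [Field K] [IsAlgClosed K]
    [AddCommGroup V] [Module K V] [FiniteDimensional K V] {f g : Module.End K V}
    (hfg : Commute f g) {W : Submodule K V} (hW : W ≠ ⊥) (hf : ∀ v ∈ W, f v ∈ W)
    (hg : ∀ v ∈ W, g v ∈ W) : ∃ v ∈ W, v ≠ 0 ∧ ∃ l m : K, f v = l • v ∧ g v = m • v := by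
  obtain ⟨l, hl⟩ := f.exists_inf_eigenspace_ne_bot hW hf
  obtain ⟨m, hm⟩ := g.exists_inf_eigenspace_ne_bot hl fun v hv => ⟨hg v hv.1, by
    have := Module.End.mem_eigenspace_iff.1 hv.2
    rw [SetLike.mem_coe, Module.End.mem_eigenspace_iff, ← Module.End.mul_apply, hfg.eq, Module.End.mul_apply, this,
      map_smul]⟩
  obtain ⟨v, hv, hv0⟩ := (Submodule.ne_bot_iff _).1 hm
  exact ⟨v, hv.1.1, hv0, l, m, Module.End.mem_eigenspace_iff.1 hv.1.2,
    Module.End.mem_eigenspace_iff.1 hv.2⟩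

/-- If a unitary `a` commutes with the commutator `a * b * a⁻¹ * b⁻¹` and the unitary `b` moves no vector to
an orthogonal one, then `a` commutes with `b`. -/
theorem LinearIsometryEquiv.commute_of_commute_commutator {E : Type*} [NormedAddCommGroup E]
    [InnerProductSpace ℂ E] [FiniteDimensional ℂ E] {a b : E ≃ₗᵢ[ℂ] E}
    (hab : Commute a (a * b * a⁻¹ * b⁻¹)) (hb : ∀ v, inner ℂ v (b v) = 0 → v = 0) : Commute a b := by
  by_contra hnab
  set D := a * b * a⁻¹ * b⁻¹ with hDdef
  have hDba : D * b * a = a * b := by rw [hDdef]; group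
  have hD : D ≠ 1 := fun h => hnab (by rw [h, one_mul] at hDba; exact hDba.symm)
  have hcomm : ∀ x, a (D x) = D (a x) := fun x => congrArg (fun e : E ≃ₗᵢ[ℂ] E => e x) hab.eq
  let f : Module.End ℂ E := a.toLinearEquiv.toLinearMap
  let g : Module.End ℂ E := D.toLinearEquiv.toLinearMap
  have hfg : Commute f g := LinearMap.ext hcomm
  -- The eigenvector is sought in the range of `D - 1`, which is orthogonal to the fixed vectors of
  -- `D`; so its `D`-eigenvalue `m` is not 1.
  have hW : LinearMap.range (g - 1) ≠ ⊥ := by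
    rw [Ne, LinearMap.range_eq_bot, sub_eq_zero]
    intro h
    exact hD (LinearIsometryEquiv.ext fun x => congrArg (fun e : Module.End ℂ E => e x) h)
  obtain ⟨v, ⟨w, hw⟩, hv0, l, m, hl, hm⟩ := Module.End.exists_common_eigenvector hfg hW
    (by
      rintro _ ⟨w, rfl⟩
      exact ⟨a w, by simp [f, g, hcomm]⟩)
    (by
      rintro _ ⟨w, rfl⟩
      exact ⟨D w, by simp [g]⟩)
  replace hw : D w - w = v := hw
  replace hl : a v = l • v := hl
  replace hm : D v = m • v := hm
  have hm1 : m ≠ 1 := by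
    rintro rfl
    rw [one_smul] at hm
    apply hv0
    rw [← inner_self_eq_zero (𝕜 := ℂ)]
    nth_rw 1 [← hw]
    rw [inner_sub_left, sub_eq_zero]
    nth_rw 1 [← hm]
    exact D.inner_map_map w v
  set u := b⁻¹ v with hu
  have hbu : b u = v := by
    change (b * b⁻¹) v = v
    simp
  have hu0 : u ≠ 0 := fun h => hv0 (by rw [← hbu, h, map_zero])
  have hDa : m • a u = l • u := by
    have h1 : D (b (a u)) = l • v := by
      rw [← hl, ← hbu]
      exact congrArg (fun e : E ≃ₗᵢ[ℂ] E => e u) hDba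
    apply b.injective
    apply D.injective
    rw [map_smul, map_smul, map_smul, map_smul, h1, hbu, hm, smul_comm]
  have hll : inner ℂ (l • u) (l • v) = inner ℂ u v := by
    have h1 : ‖l‖ = 1 := by
      have h2 : ‖l • v‖ = ‖v‖ := by rw [← hl, a.norm_map]
      rw [norm_smul] at h2
      exact (mul_eq_right₀ (norm_ne_zero_iff.2 hv0)).1 h2
    rw [inner_smul_left, inner_smul_right, ← mul_assoc, Complex.conj_mul', h1]
    simp
  -- Unitarity of `a` compares the inner product with its multiple by the conjugate of `m`; as `m ≠
  -- 1`, `u` is orthogonal to `b u = v`.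
  have h0 : inner ℂ u v = 0 := by
    have h1 : inner ℂ (m • a u) (a v) = inner ℂ u v := by rw [hDa, hl, hll]
    rw [inner_smul_left, a.inner_map_map] at h1
    have h2 : (starRingEnd ℂ m - 1) * inner ℂ u v = 0 := by rw [sub_mul, h1, one_mul, sub_self]
    refine (mul_eq_zero.1 h2).resolve_left fun h => hm1 ?_
    rw [sub_eq_zero] at h
    simpa using congrArg (starRingEnd ℂ) h
  exact hu0 (hb u (by rw [hbu]; exact h0))

/-- Subtracting 1 from both factors does not change `ab - ba`, so the commutator is quadratically
close to 1. -/
theorem Unitary.norm_commutator_sub_one_le {A : Type*} [NormedRing A] [StarRing A] [CStarRing A]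
    (a b : unitary A) :
    ‖((a * b * a⁻¹ * b⁻¹ : unitary A) : A) - 1‖ ≤ 2 * ‖(a : A) - 1‖ * ‖(b : A) - 1‖ := by
  have h1 : ((a * b * a⁻¹ * b⁻¹ : unitary A) : A) - 1 =
      (((a : A) - 1) * (b - 1) - ((b : A) - 1) * (a - 1)) * ((b * a)⁻¹ : unitary A) := by
    have h2 : ((a : A) - 1) * (b - 1) - ((b : A) - 1) * (a - 1) =
        (a * b : unitary A) - (b * a : unitary A) := by
      push_cast
      noncomm_ring
    rw [h2, sub_mul, ← Submonoid.coe_mul, ← Submonoid.coe_mul, mul_inv_cancel, mul_inv_rev,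
      ← mul_assoc]
    simp
  rw [h1, CStarRing.norm_mul_coe_unitary]
  refine (norm_sub_le _ _).trans ?_
  have h3 := norm_mul_le ((a : A) - 1) (b - 1)
  have h4 := norm_mul_le ((b : A) - 1) (a - 1)
  linarith

theorem Unitary.norm_inv_mul_sub_one {A : Type*} [NormedRing A] [StarRing A] [CStarRing A]
    (a b : unitary A) : ‖((a⁻¹ * b : unitary A) : A) - 1‖ = ‖(b : A) - a‖ := by
  rw [← CStarRing.norm_coe_unitary_mul a⁻¹ ((b : A) - a), mul_sub, ← Submonoid.coe_mul,
    ← Submonoid.coe_mul, inv_mul_cancel, Submonoid.coe_one]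

section

variable {E : Type*} [NormedAddCommGroup E] [InnerProductSpace ℂ E] [FiniteDimensional ℂ E]

/-- In a finite group of unitary operators, any two elements close to the identity commute. -/
theorem Unitary.commute_of_norm_sub_one_lt {G : Subgroup (unitary (E →L[ℂ] E))}
    (hG : (G : Set (unitary (E →L[ℂ] E))).Finite) {a b : unitary (E →L[ℂ] E)}
    (ha : a ∈ G) (hb : b ∈ G) (ha' : ‖(a : E →L[ℂ] E) - 1‖ < 1 / 2)
    (hb' : ‖(b : E →L[ℂ] E) - 1‖ < 1 / 2) : Commute a b := by
  by_contra hab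
  -- Take `c` nearest to 1 among the elements not commuting with `a`. The commutator of `a` and `c`
  -- is nearer still, hence commutes with `a`.
  obtain ⟨c, ⟨hcG, hc', hac⟩, hmin⟩ := Set.exists_min_image
    {c | c ∈ G ∧ ‖(c : E →L[ℂ] E) - 1‖ < 1 / 2 ∧ ¬ Commute a c}
    (fun c => ‖(c : E →L[ℂ] E) - 1‖) (hG.subset fun c hc => hc.1) ⟨b, hb, hb', hab⟩
  have hc0 : 0 < ‖(c : E →L[ℂ] E) - 1‖ := by
    rw [norm_pos_iff, sub_ne_zero]
    intro h
    have : c = 1 := Subtype.ext h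
    exact hac (this ▸ Commute.one_right a)
  have hlt : ‖((a * c * a⁻¹ * c⁻¹ : unitary (E →L[ℂ] E)) : E →L[ℂ] E) - 1‖ <
      ‖(c : E →L[ℂ] E) - 1‖ := by
    have := Unitary.norm_commutator_sub_one_le a c
    nlinarith
  have hcomm : Commute a (a * c * a⁻¹ * c⁻¹) := by
    by_contra h
    exact absurd (hmin _ ⟨G.mul_mem (G.mul_mem (G.mul_mem ha hcG) (G.inv_mem ha)) (G.inv_mem hcG),
      hlt.trans hc', h⟩) (not_le.2 hlt)
  refine hac ?_
  let e := Unitary.linearIsometryEquiv (𝕜 := ℂ) (H := E)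
  have h1 : Commute (e a) (e a * e c * (e a)⁻¹ * (e c)⁻¹) := by
    simpa only [map_mul, map_inv] using hcomm.map e
  have h2 : Commute (e a) (e c) := by
    refine LinearIsometryEquiv.commute_of_commute_commutator h1 fun v hv => ?_
    have hv1 : ‖e c v - v‖ ≤ 1 / 2 * ‖v‖ :=
      ((c : E →L[ℂ] E) - 1).le_of_opNorm_le hc'.le v
    have hv2 := inner_self_eq_norm_sq_to_K (𝕜 := ℂ) v
    have hv3 : ‖e c v - v‖ ^ 2 = ‖v‖ ^ 2 + ‖v‖ ^ 2 := by
      rw [norm_sub_sq (𝕜 := ℂ), inner_eq_zero_symm.1 hv, (e c).norm_map]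
      simp
    have : ‖v‖ = 0 := by nlinarith [norm_nonneg v, norm_nonneg (e c v - v)]
    exact norm_eq_zero.1 this
  exact e.injective (by simpa only [map_mul] using h2.eq)

variable (E) in
/-- **Jordan's theorem** on finite linear groups: a finite group of unitary operators has an
abelian subgroup whose index is bounded in terms of the space only. -/
theorem Unitary.exists_index_le_forall_commute : ∃ K : ℕ, ∀ {Γ : Type*} [Group Γ]
    (π : Γ →* unitary (E →L[ℂ] E)), (Set.range π).Finite →
      ∃ H : Subgroup Γ, H.FiniteIndex ∧ H.index ≤ K ∧ ∀ a ∈ H, ∀ b ∈ H, Commute (π a) (π b) := by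
  have htb := (isCompact_closedBall (0 : E →L[ℂ] E) 1).totallyBounded
  -- Radius 1/4 puts two elements of one ball within 1/2, so their quotient lies in `S` below.
  obtain ⟨t, ht, hcover⟩ := Metric.totallyBounded_iff.1 htb (1 / 4) (by norm_num)
  refine ⟨Nat.card t, fun {Γ} _ π hπ => ?_⟩
  have hball : ∀ g, ∃ y : t, dist (π g : E →L[ℂ] E) y < 1 / 4 := by
    intro g
    have : (π g : E →L[ℂ] E) ∈ Metric.closedBall (0 : E →L[ℂ] E) 1 := by
      rw [mem_closedBall_zero_iff]
      exact ContinuousLinearMap.opNorm_le_bound _ zero_le_one fun v => by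
        rw [ContinuousLinearMap.norm_map_of_mem_unitary (π g).2, one_mul]
    obtain ⟨y, hy, hgy⟩ := Set.mem_iUnion₂.1 (hcover this)
    exact ⟨⟨y, hy⟩, hgy⟩
  choose c hc using hball
  let S : Set Γ := {g | ‖(π g : E →L[ℂ] E) - 1‖ < 1 / 2}
  have hSS : ∀ a ∈ S, ∀ b ∈ S, Commute (π a) (π b) := fun a ha b hb =>
    Unitary.commute_of_norm_sub_one_lt (G := π.range) (by simpa using hπ) ⟨a, rfl⟩ ⟨b, rfl⟩ ha hb
  have hinj : Function.Injective fun q : Γ ⧸ Subgroup.closure S => c q.out := by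
    intro p q hpq
    rw [← QuotientGroup.out_eq' p, ← QuotientGroup.out_eq' q]
    refine QuotientGroup.eq.2 (Subgroup.subset_closure ?_)
    change ‖((π (p.out⁻¹ * q.out) : unitary (E →L[ℂ] E)) : E →L[ℂ] E) - 1‖ < 1 / 2
    rw [map_mul, map_inv, Unitary.norm_inv_mul_sub_one, ← dist_eq_norm]
    have h1 := hc p.out
    have h2 := hc q.out
    simp only at hpq
    rw [hpq] at h1
    linarith [dist_triangle_right (π q.out : E →L[ℂ] E) (π p.out) (c q.out)]
  have := ht.to_subtype
  have hfin : Finite (Γ ⧸ Subgroup.closure S) := Finite.of_injective _ hinj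
  refine ⟨Subgroup.closure S, Subgroup.finiteIndex_of_finite_quotient, ?_, ?_⟩
  · exact Nat.card_le_card_of_injective _ hinj
  · have h1 : Subgroup.closure S ≤ (Subgroup.centralizer (π '' S)).comap π := by
      rw [Subgroup.closure_le]
      rintro a ha _ ⟨b, hb, rfl⟩
      exact hSS b hb a ha
    have h2 : Subgroup.closure S ≤
        (Subgroup.centralizer (π '' (Subgroup.closure S))).comap π := by
      rw [Subgroup.closure_le]
      rintro a ha _ ⟨b, hb, rfl⟩
      exact (h1 hb _ ⟨a, ha, rfl⟩).symm
    intro a ha b hb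
    exact (h2 ha _ ⟨b, hb, rfl⟩).symm

end

/-! ### Irreducibles with finite image -/

/-- An element acting nontrivially in a unitary representation acts nontrivially on some minimal
invariant subspace. -/
theorem LinearIsometryEquiv.exists_minimal_invariant {Γ E : Type*} [Group Γ]
    [NormedAddCommGroup E] [InnerProductSpace ℂ E] [FiniteDimensional ℂ E]
    (σ : Γ →* (E ≃ₗᵢ[ℂ] E)) {γ : Γ} (hγ : σ γ ≠ 1) :
    ∃ W : Submodule ℂ E, (∀ g, ∀ v ∈ W, σ g v ∈ W) ∧ (∃ v ∈ W, σ γ v ≠ v) ∧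
      ∀ U ≤ W, (∀ g, ∀ v ∈ U, σ g v ∈ U) → U = ⊥ ∨ U = W := by
  obtain ⟨W, hW, hmin⟩ := (measure fun W : Submodule ℂ E => Module.finrank ℂ W).wf.has_min
    {W : Submodule ℂ E | (∀ g, ∀ v ∈ W, σ g v ∈ W) ∧ ∃ v ∈ W, σ γ v ≠ v}
    ⟨⊤, by simp, by
      by_contra! h
      exact hγ (LinearIsometryEquiv.ext fun v => h v trivial)⟩
  have hmin' : ∀ U ≤ W, (∀ g, ∀ v ∈ U, σ g v ∈ U) → (∃ v ∈ U, σ γ v ≠ v) → U = W :=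
    fun U hUW hU hv => Submodule.eq_of_le_of_finrank_le hUW (not_lt.1 (hmin U ⟨hU, hv⟩))
  refine ⟨W, hW.1, hW.2, fun U hUW hU => ?_⟩
  by_cases hv : ∃ v ∈ U, σ γ v ≠ v
  · exact Or.inr (hmin' U hUW hU hv)
  left
  push Not at hv
  -- If `γ` fixes `U` pointwise, it must move a vector of the complement, which by minimality is all
  -- of `W`; then `U` is orthogonal to itself.
  have hperp : Uᗮ ⊓ W = W := by
    refine hmin' _ inf_le_right (fun g v hgv => ⟨?_, hW.1 g v hgv.2⟩) ?_
    · refine (Submodule.mem_orthogonal _ _).2 fun u hu => ?_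
      have h1 := (Submodule.mem_orthogonal _ _).1 hgv.1 _ (hU g⁻¹ u hu)
      rw [← (σ g).inner_map_map] at h1
      simpa using h1
    · by_contra! h
      obtain ⟨w, hw, hne⟩ := hW.2
      apply hne
      obtain ⟨u, hu, u', hu', rfl⟩ := Submodule.exists_add_mem_mem_orthogonal (K := U) w
      rw [map_add, hv u hu, h u' ⟨hu', by simpa using W.sub_mem hw (hUW hu)⟩]
  rw [eq_bot_iff]
  intro u hu
  have h1 : u ∈ Uᗮ ⊓ W := by rw [hperp]; exact hUW hu
  exact inner_self_eq_zero.1 ((Submodule.mem_orthogonal _ _).1 h1.1 u hu)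

/-- The matrices of a unitary representation on an invariant subspace. -/
theorem LinearIsometryEquiv.exists_unitaryGroup_hom {Γ E : Type*} [Group Γ]
    [NormedAddCommGroup E] [InnerProductSpace ℂ E] [FiniteDimensional ℂ E]
    (σ : Γ →* (E ≃ₗᵢ[ℂ] E)) (W : Submodule ℂ E) (hW : ∀ g, ∀ v ∈ W, σ g v ∈ W) :
    ∃ (n : ℕ) (e : (Fin n → ℂ) →ₗ[ℂ] E) (π : Γ →* Matrix.unitaryGroup (Fin n) ℂ),
      Function.Injective e ∧ LinearMap.range e = W ∧
      ∀ g v, e ((π g : Matrix (Fin n) (Fin n) ℂ).mulVec v) = σ g (e v) := by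
  let b := stdOrthonormalBasis ℂ W
  let φ : Γ →* Module.End ℂ W :=
    { toFun := fun g => (σ g).toLinearEquiv.toLinearMap.restrict (hW g)
      map_one' := by ext; simp
      map_mul' := fun g h => by ext; simp }
  have hφ : ∀ g, φ g ∈ unitary (Module.End ℂ W) := by
    intro g
    have h : ∀ g, star (φ g) = φ g⁻¹ := fun g => by
      rw [LinearMap.star_eq_adjoint, eq_comm, LinearMap.eq_adjoint_iff]
      intro x y
      have h1 := (σ g).inner_map_map (σ g⁻¹ x) (y : E)
      rw [show σ g (σ g⁻¹ x) = x by simp] at h1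
      exact h1.symm
    rw [Unitary.mem_iff, h, ← map_mul, ← map_mul]
    simp
  let M := LinearMap.toMatrixOrthonormal b
  have hM : ∀ g, M (φ g) ∈ Matrix.unitaryGroup (Fin (Module.finrank ℂ W)) ℂ := by
    intro g
    rw [Matrix.mem_unitaryGroup_iff, ← map_star, ← map_mul, Unitary.mul_star_self_of_mem (hφ g),
      map_one]
  let π : Γ →* Matrix.unitaryGroup (Fin (Module.finrank ℂ W)) ℂ :=
    { toFun := fun g => ⟨M (φ g), hM g⟩
      map_one' := Subtype.ext ((congrArg M (map_one φ)).trans (map_one M))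
      map_mul' := fun g h => Subtype.ext ((congrArg M (map_mul φ g h)).trans (map_mul M _ _)) }
  let e := b.toBasis.equivFun.symm
  refine ⟨_, W.subtype ∘ₗ e.toLinearMap, π, ?_, ?_, ?_⟩
  · exact W.injective_subtype.comp e.injective
  · rw [LinearMap.range_comp, LinearEquiv.range, Submodule.map_top, W.range_subtype]
  · intro g v
    have h1 : (π g : Matrix _ _ ℂ) = LinearMap.toMatrix b.toBasis b.toBasis (φ g) := rfl
    have h2 : e ((π g : Matrix _ _ ℂ).mulVec v) = φ g (e v) := by
      rw [h1, LinearEquiv.symm_apply_eq]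
      have := LinearMap.toMatrix_mulVec_repr b.toBasis b.toBasis (φ g) (e v)
      rwa [show ⇑(b.toBasis.repr (e v)) = v from e.symm_apply_apply v] at this
    exact congrArg Subtype.val h2

/-- The unitary operators permuting the coordinates of `ℓ²(X)` through an action on `X`. -/
noncomputable def permIsometry (Γ X : Type*) [Group Γ] [MulAction Γ X] [Fintype X] :
    Γ →* (EuclideanSpace ℂ X ≃ₗᵢ[ℂ] EuclideanSpace ℂ X) where
  toFun g := LinearIsometryEquiv.piLpCongrLeft 2 ℂ ℂ (MulAction.toPerm g)
  map_one' := by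
    ext v x
    simp [LinearIsometryEquiv.piLpCongrLeft_apply, Equiv.piCongrLeft'_apply, MulAction.toPerm]
  map_mul' g h := by
    ext v x
    simp [LinearIsometryEquiv.piLpCongrLeft_apply, Equiv.piCongrLeft'_apply, MulAction.toPerm,
      mul_smul]

/-- An element moving a point of a finite set acts nontrivially in some irreducible unitary
representation with finite image. -/
theorem exists_irreducible_unitaryRep_ne_one {Γ X : Type*} [Group Γ] [MulAction Γ X] [Finite X]
    {γ : Γ} {x : X} (hx : γ • x ≠ x) :
    ∃ (n : ℕ) (π : Γ →* Matrix.unitaryGroup (Fin n) ℂ), (unitaryRep π).IsIrreducible ∧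
      (Set.range π).Finite ∧ π γ ≠ 1 := by
  classical
  have := Fintype.ofFinite X
  let σ := permIsometry Γ X
  have hσ : σ γ ≠ 1 := by
    intro h
    have h1 : σ γ (EuclideanSpace.single x 1) = EuclideanSpace.single (γ • x) 1 :=
      LinearIsometryEquiv.piLpCongrLeft_single _ _ _
    rw [h] at h1
    have h2 := congrArg (fun v : EuclideanSpace ℂ X => v (γ • x)) h1
    simp [hx] at h2
  obtain ⟨W, hW, ⟨w, hwW, hw⟩, hmin⟩ := LinearIsometryEquiv.exists_minimal_invariant σ hσ
  obtain ⟨n, e, π, he, heW, heπ⟩ := LinearIsometryEquiv.exists_unitaryGroup_hom σ W hW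
  have hrep : ∀ g v, e (unitaryRep π g v) = σ g (e v) := fun g v => heπ g v
  obtain ⟨u, rfl⟩ : w ∈ LinearMap.range e := heW ▸ hwW
  refine ⟨n, π, ?_, ?_, fun h => hw ?_⟩
  · have hnt : Nontrivial (Subrepresentation (unitaryRep π)) := by
      refine ⟨⊥, ⊤, fun h => hw ?_⟩
      have hu : u ∈ (⊤ : Subrepresentation (unitaryRep π)) := Submodule.mem_top
      rw [← h] at hu
      have hu0 : u = 0 := hu
      rw [hu0, map_zero, map_zero]
    refine { hnt with eq_bot_or_eq_top := fun U => ?_ }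
    have hU := hmin (U.toSubmodule.map e) (heW ▸ LinearMap.map_le_range) (by
      rintro g _ ⟨v, hv, rfl⟩
      exact ⟨_, U.apply_mem_toSubmodule g hv, hrep g v⟩)
    refine hU.imp (fun h => ?_) fun h => ?_
    · exact Subrepresentation.toSubmodule_injective
        (Submodule.map_injective_of_injective he (h.trans (Submodule.map_bot _).symm))
    · refine Subrepresentation.toSubmodule_injective
        (Submodule.map_injective_of_injective he (h.trans ?_))
      rw [← heW]
      exact LinearMap.range_eq_map e
  -- `π g` depends only on the permutation of `X` induced by `g`, so the image is finite.
  · have hfac : Function.FactorsThrough π (MulAction.toPermHom Γ X) := by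
      intro g h hgh
      have hσgh : σ g = σ h :=
        congrArg (LinearIsometryEquiv.piLpCongrLeft 2 ℂ ℂ) hgh
      refine Subtype.ext (Matrix.toLin'.injective (LinearMap.ext fun v => he ?_))
      exact (heπ g v).trans ((congrArg (fun f => f (e v)) hσgh).trans (heπ h v).symm)
    obtain ⟨F, hF⟩ := (Function.factorsThrough_iff _).1 hfac
    rw [hF]
    exact (Set.finite_range F).subset (Set.range_comp_subset_range _ _)
  · rw [← heπ, h]
    simp

/-- Unitary matrices as unitary operators on Euclidean space. -/
noncomputable def Matrix.unitaryGroupToCLM (n : ℕ) : Matrix.unitaryGroup (Fin n) ℂ →*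
    unitary (EuclideanSpace ℂ (Fin n) →L[ℂ] EuclideanSpace ℂ (Fin n)) :=
  let T := Matrix.toEuclideanCLM (n := Fin n) (𝕜 := ℂ)
  { toFun := fun U => ⟨T U, Unitary.map_mem T U.2⟩
    map_one' := Subtype.ext (map_one T)
    map_mul' := fun _ _ => Subtype.ext (map_mul T _ _) }

theorem Matrix.unitaryGroupToCLM_injective (n : ℕ) :
    Function.Injective (Matrix.unitaryGroupToCLM n) := fun _ _ h =>
  Subtype.ext ((Matrix.toEuclideanCLM (n := Fin n) (𝕜 := ℂ)).injective (congrArg Subtype.val h))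

theorem isVirtuallyAbelian_of_bounded_irreducible (Γ : Type*) [Group Γ] [Group.FG Γ]
    [Group.ResiduallyFinite Γ] (N : ℕ)
    (hN : ∀ (n : ℕ) (π : Γ →* Matrix.unitaryGroup (Fin n) ℂ),
      (unitaryRep π).IsIrreducible → n < N) : IsVirtuallyAbelian Γ := by
  choose K hK using fun n : ℕ =>
    Unitary.exists_index_le_forall_commute (EuclideanSpace ℂ (Fin n))
  obtain ⟨L, hL, hLH⟩ :=
    Group.exists_finiteIndex_le_of_index_le Γ ((Finset.range N).sup K)
  refine ⟨L, IsMulCommutative.of_setLike_mul_comm fun a ha b hb => ?_, hL⟩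
  by_contra hab
  have hγ : a * b * (b * a)⁻¹ ≠ 1 := fun h => hab (mul_inv_eq_one.1 h)
  obtain ⟨H₀, hH₀⟩ := Group.exists_finiteIndexNormalSubgroup_notMem _ hγ
  -- An element outside `H₀` moves the trivial coset.
  have hx : (a * b * (b * a)⁻¹) • ((1 : Γ) : Γ ⧸ H₀.toSubgroup) ≠ (1 : Γ) := by
    intro h
    have h1 : ((a * b * (b * a)⁻¹ * 1 : Γ) : Γ ⧸ H₀.toSubgroup) = (1 : Γ) := h
    rw [mul_one, eq_comm, QuotientGroup.eq, inv_one, one_mul] at h1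
    exact hH₀ h1
  obtain ⟨n, π, hirr, hfin, hne⟩ := exists_irreducible_unitaryRep_ne_one hx
  obtain ⟨H, hH, hHK, hcomm⟩ := hK n ((Matrix.unitaryGroupToCLM n).comp π) (by
    rw [MonoidHom.coe_comp, Set.range_comp]
    exact hfin.image _)
  have hLle := hLH H hH
    (hHK.trans (Finset.le_sup (f := K) (Finset.mem_range.2 (hN n π hirr))))
  apply hne
  rw [map_mul, map_inv, mul_inv_eq_one]
  apply Matrix.unitaryGroupToCLM_injective
  let φ := (Matrix.unitaryGroupToCLM n).comp π
  exact (φ.map_mul a b).trans ((hcomm a (hLle ha) b (hLle hb)).eq.trans (φ.map_mul b a).symm)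

theorem lemma2p4 (Γ : Type*) [Group Γ] :
    (∀ (d : ℕ) (A : Subgroup Γ), IsMulCommutative A → A.FiniteIndex → A.index ≤ d →
      ∀ (V : Type*) [AddCommGroup V] [Module ℂ V] [FiniteDimensional ℂ V]
        (ρ : Representation ℂ Γ V), ρ.IsIrreducible → Module.finrank ℂ V ≤ d) ∧
    (Group.FG Γ → Group.ResiduallyFinite Γ → ¬ IsVirtuallyAbelian Γ →
      ∀ N : ℕ, ∃ n : ℕ, N ≤ n ∧ ∃ π : Γ →* Matrix.unitaryGroup (Fin n) ℂ,
        (unitaryRep π).IsIrreducible) := by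
  refine ⟨fun d A hA hfin hd V _ _ _ ρ hρ => (hρ.finrank_le_index A).trans hd,
    fun hFG hRF hnva N => ?_⟩
  by_contra! h
  exact hnva (isVirtuallyAbelian_of_bounded_irreducible Γ N fun n π hπ =>
    not_le.1 fun hn => h n hn π hπ)
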